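/- Let $G$ be a unimodular locally compact Hausdorff group with Haar measure $\mu_G$, let $H$ be a closed normal subgroup of $G$, let $\pi : G \to G/H$ be the quotient map, and let $\mu_{G/H}$ be a Haar measure on $G/H$. Let $A \subseteq G$ be a $\sigma$-compact set with $0 < \mu_G(A) < \infty$, and let $K$ be a real number such that $\mu_G(A^2) \le K \mu_G(A)$, where $XY = \{xy : x \in X,\ y \in Y\}$ and $X^2 = XX$. Then for every real $\alpha > 1$ there is a compact set $B \subseteq A$ such that $$\mu_G(B) > \frac{\alpha-1}{\alpha}\,\mu_G(A) \qquad\text{and}\qquad \mu_{G/H}\big(\pi(B)^2\big) < \alpha K\,\mu_{G/H}\big(\pi(B)\big).$$ -/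

import Mathlib

open scoped Pointwise

open MeasureTheory Set Topology Filter

/-! Let `F` and `F'` be the functions on `G ⧸ H` giving the Haar measures of the fibres of `A` and
of `A * A`. By Weil's formula, after normalising, their integrals are the measures of `A` and `A *
A`. Translating a fibre of `A` by an element of `A` gives `F y ≤ F' (x * y)` for `x` in the image of
`A`, so the product of `{F > t}` with itself lies in `{F' > t}` (`fiberMeasure_le_mul`). By the
layer cake formula the measures of these superlevel sets integrate over `t` to `∫ F` and `∫ F'`,
whose ratio is at most `K`. Averaging only over small `t` costs a factor `α` and yields a level
below which `F` carries less than `1/α` of its mass (`exists_level_lt`). The part of `A` over `{F >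
t}` then has both properties, and an exhaustion by compact sets (`exists_isCompact_exhaustion`)
preserves them because both inequalities are strict. -/

/-- A Borel measure on `G` that is carried by the subgroup `H` and restricts to a left Haar
measure on it. -/
structure IsSubgroupHaar {G : Type*} [Group G] [TopologicalSpace G] [MeasurableSpace G]
    (H : Subgroup G) (ρ : Measure G) : Prop where
  smul : ∀ h ∈ H, ∀ S : Set G, MeasurableSet S → ρ (h • S) = ρ S
  compl : ρ (H : Set G)ᶜ = 0
  lt_top : ∀ K : Set G, IsCompact K → ρ K < ⊤
  pos : ∀ U : Set G, IsOpen U → (U ∩ H).Nonempty → 0 < ρ U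
  exists_isOpen : ∀ K : Set G, IsCompact K → ∀ r, ρ K < r → ∃ U, K ⊆ U ∧ IsOpen U ∧ ρ U < r

/-- The measure of the fibre of `S` over a coset `gH`, namely `ρ (g⁻¹ S)`. -/
noncomputable def fiberMeasure {G : Type*} [Group G] [MeasurableSpace G] {H : Subgroup G}
    (ρ : Measure G) (S : Set G) (x : G ⧸ H) : ENNReal :=
  ρ (x.out⁻¹ • S)

/-! ### Haar measure of the subgroup and fibre measures. -/

section Fiber

variable {G : Type*} [Group G] [TopologicalSpace G] [IsTopologicalGroup G]
  [MeasurableSpace G] [BorelSpace G]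

theorem exists_isSubgroupHaar [LocallyCompactSpace G] [T2Space G] (H : Subgroup G)
    (hH : IsClosed (H : Set G)) : ∃ ρ : Measure G, IsSubgroupHaar H ρ := by
  have emb : IsClosedEmbedding ((↑) : H → G) := hH.isClosedEmbedding_subtypeVal
  have : LocallyCompactSpace H := emb.locallyCompactSpace
  have : BorelSpace H := inferInstanceAs (BorelSpace (H : Set G))
  have hm : Measurable ((↑) : H → G) := measurable_subtype_coe
  refine ⟨(Measure.haar : Measure H).map (↑), ?_, ?_, ?_, ?_, ?_⟩
  · intro h hh S hS
    rw [Measure.map_apply hm (hS.const_smul h), Measure.map_apply hm hS]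
    rw [← measure_preimage_mul _ (⟨h, hh⟩ : H)⁻¹ ((↑) ⁻¹' S)]
    congr 1
    ext x
    simp [mem_smul_set_iff_inv_smul_mem]
  · rw [Measure.map_apply hm hH.measurableSet.compl]
    convert measure_empty (μ := (Measure.haar : Measure H))
    ext x
    simp
  · intro K hK
    rw [Measure.map_apply hm hK.measurableSet]
    exact (emb.isCompact_preimage hK).measure_lt_top
  · rintro U hU ⟨x, hxU, hxH⟩
    rw [Measure.map_apply hm hU.measurableSet]
    exact (hU.preimage continuous_subtype_val).measure_pos _ ⟨⟨x, hxH⟩, hxU⟩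
  · intro K hK r hr
    rw [Measure.map_apply hm hK.measurableSet] at hr
    obtain ⟨V, hKV, hV, hVr⟩ := Set.exists_isOpen_lt_of_lt _ r hr
    obtain ⟨W, hW, rfl⟩ := isOpen_induced_iff.1 hV
    -- Adding the null complement of `H` covers the points of `K` outside `H` at no cost.
    refine ⟨W ∪ (H : Set G)ᶜ, ?_, hW.union hH.isOpen_compl, ?_⟩
    · intro x hx
      by_cases hxH : x ∈ H
      · exact Or.inl (hKV (show (⟨x, hxH⟩ : H) ∈ _ from hx))
      · exact Or.inr hxH
    · rw [Measure.map_apply hm (hW.union hH.isOpen_compl).measurableSet]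
      convert hVr using 2
      ext x
      simp

namespace IsSubgroupHaar

variable {H : Subgroup G} {ρ : Measure G}

/-- Two representatives of a coset differ by an element of `H`, under which `ρ` is invariant. -/
theorem fiberMeasure_mk (hρ : IsSubgroupHaar H ρ) {S : Set G} (hS : MeasurableSet S) (g : G) :
    fiberMeasure ρ S (g : G ⧸ H) = ρ (g⁻¹ • S) := by
  obtain ⟨h, hh⟩ := QuotientGroup.mk_out_eq_mul H g
  rw [fiberMeasure, hh, mul_inv_rev, mul_smul, hρ.smul _ (H.inv_mem h.2) _ (hS.const_smul _)]

theorem measure_inter (hρ : IsSubgroupHaar H ρ) (S : Set G) : ρ (S ∩ H) = ρ S :=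
  measure_inter_conull hρ.compl

theorem fiberMeasure_inter_preimage (hρ : IsSubgroupHaar H ρ) (S : Set G) (T : Set (G ⧸ H)) (x : G ⧸ H) :
    fiberMeasure ρ (S ∩ (↑) ⁻¹' T) x = T.indicator (fiberMeasure ρ S) x := by
  have key : ∀ y ∈ H, ((x.out * y : G) : G ⧸ H) = x := fun y hy => by
    rw [QuotientGroup.mk_mul_of_mem _ hy, QuotientGroup.out_eq']
  by_cases hx : x ∈ T
  · rw [indicator_of_mem hx, fiberMeasure, fiberMeasure, ← hρ.measure_inter,
      ← hρ.measure_inter (_ • S)]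
    congr 1
    ext y
    simp only [mem_inter_iff, mem_smul_set_iff_inv_smul_mem, inv_inv, smul_eq_mul, mem_preimage,
      SetLike.mem_coe]
    constructor
    · rintro ⟨⟨h1, -⟩, h2⟩
      exact ⟨h1, h2⟩
    · rintro ⟨h1, h2⟩
      exact ⟨⟨h1, by rwa [key y h2]⟩, h2⟩
  · rw [indicator_of_notMem hx, fiberMeasure, ← hρ.measure_inter]
    convert measure_empty (μ := ρ)
    ext y
    simp only [mem_inter_iff, mem_smul_set_iff_inv_smul_mem, inv_inv, smul_eq_mul, mem_preimage,
      SetLike.mem_coe, mem_empty_iff_false, iff_false]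
    rintro ⟨⟨-, h1⟩, h2⟩
    rw [key y h2] at h1
    exact hx h1

theorem fiberMeasure_eq_zero (hρ : IsSubgroupHaar H ρ) {S : Set G} {x : G ⧸ H} (hx : x ∉ ((↑) : G → G ⧸ H) '' S) :
    fiberMeasure ρ S x = 0 := by
  have := hρ.fiberMeasure_inter_preimage S (((↑) : G → G ⧸ H) '' S) x
  rwa [inter_eq_left.2 (subset_preimage_image _ _), indicator_of_notMem hx] at this

theorem fiberMeasure_smul (hρ : IsSubgroupHaar H ρ) {S : Set G} (hS : MeasurableSet S) (g : G) (x : G ⧸ H) :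
    fiberMeasure ρ (g • S) x = fiberMeasure ρ S (g⁻¹ • x) := by
  induction x using QuotientGroup.induction_on with
  | H a =>
    rw [hρ.fiberMeasure_mk (hS.const_smul g), MulAction.Quotient.smul_coe, hρ.fiberMeasure_mk hS,
      smul_smul]
    simp


theorem fiberMeasure_pos (hρ : IsSubgroupHaar H ρ) {U : Set G} (hU : IsOpen U) {g : G}
    (hg : g ∈ U) : 0 < fiberMeasure ρ U (g : G ⧸ H) := by
  rw [hρ.fiberMeasure_mk hU.measurableSet]
  refine hρ.pos _ (hU.smul _) ⟨1, ?_, H.one_mem⟩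
  simpa [mem_smul_set_iff_inv_smul_mem] using hg

/-- Outer regularity puts `g⁻¹ • K` in an open set of small measure; by compactness of `K`, nearby
translates stay in it. -/
theorem upperSemicontinuous_fiberMeasure [T2Space G] (hρ : IsSubgroupHaar H ρ) {K : Set G}
    (hK : IsCompact K) : UpperSemicontinuous (fiberMeasure (H := H) ρ K) := by
  rw [upperSemicontinuous_iff_isOpen_preimage]
  intro r
  rw [← (QuotientGroup.isQuotientMap_mk (N := H)).isOpen_preimage, isOpen_iff_mem_nhds]
  intro g hg
  simp only [mem_preimage, mem_Iio, hρ.fiberMeasure_mk hK.measurableSet] at hg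
  obtain ⟨U, hKU, hU, hUr⟩ := hρ.exists_isOpen _ (hK.smul g⁻¹) r hg
  have hsub : ∀ k ∈ K, ∀ᶠ p : G × G in 𝓝 (g, k), p.1⁻¹ * p.2 ∈ U := fun k hk => by
    have : Continuous fun p : G × G => p.1⁻¹ * p.2 := by fun_prop
    exact this.continuousAt.eventually (hU.mem_nhds (hKU (smul_mem_smul_set hk)))
  filter_upwards [hK.eventually_forall_of_forall_eventually (P := fun a k => a⁻¹ * k ∈ U) hsub]
    with a ha
  simp only [mem_preimage, mem_Iio, hρ.fiberMeasure_mk hK.measurableSet]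
  refine (measure_mono ?_).trans_lt hUr
  rintro _ ⟨k, hk, rfl⟩
  exact ha k hk

/-- If `s ∈ S` lies over `x`, then `s • T ⊆ S * T`, and translation by `s` carries the fibre of `T`
over `y` to one over `x * y`. -/
theorem fiberMeasure_le_mul [H.Normal] (hρ : IsSubgroupHaar H ρ) {S T : Set G}
    (hT : MeasurableSet T) (hST : MeasurableSet (S * T)) {x y : G ⧸ H}
    (hx : x ∈ ((↑) : G → G ⧸ H) '' S) :
    fiberMeasure ρ T y ≤ fiberMeasure ρ (S * T) (x * y) := by
  obtain ⟨s, hs, rfl⟩ := hx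
  induction y using QuotientGroup.induction_on with
  | H g =>
    rw [← QuotientGroup.mk_mul, hρ.fiberMeasure_mk hT, hρ.fiberMeasure_mk hST]
    refine measure_mono ?_
    rw [mul_inv_rev, mul_smul]
    refine smul_set_mono fun t ht => ?_
    rw [mem_smul_set_iff_inv_smul_mem, inv_inv]
    exact mul_mem_mul hs ht

end IsSubgroupHaar

section Basic

variable {H : Subgroup G} (ρ : Measure G)

theorem fiberMeasure_mono {S T : Set G} (h : S ⊆ T) (x : G ⧸ H) :
    fiberMeasure ρ S x ≤ fiberMeasure ρ T x :=
  measure_mono (smul_set_mono h)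

theorem fiberMeasure_union_le (S T : Set G) (x : G ⧸ H) :
    fiberMeasure ρ (S ∪ T) x ≤ fiberMeasure ρ S x + fiberMeasure ρ T x := by
  rw [fiberMeasure, smul_set_union]
  exact measure_union_le _ _

theorem fiberMeasure_union {S T : Set G} (h : Disjoint S T) (hT : MeasurableSet T) (x : G ⧸ H) :
    fiberMeasure ρ (S ∪ T) x = fiberMeasure ρ S x + fiberMeasure ρ T x := by
  rw [fiberMeasure, smul_set_union]
  exact measure_union (disjoint_smul_set.2 h) (hT.const_smul _)

theorem fiberMeasure_iUnion {C : ℕ → Set G} (hC : Monotone C) (x : G ⧸ H) :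
    fiberMeasure ρ (⋃ n, C n) x = ⨆ n, fiberMeasure ρ (C n) x := by
  rw [fiberMeasure, smul_set_iUnion]
  exact Monotone.measure_iUnion fun m n h => smul_set_mono (hC h)

end Basic

end Fiber

/-! ### Layer cake and the choice of a level. -/

/-- Layer cake formula for a truncated `ENNReal`-valued function. -/
theorem lintegral_min_eq_setLIntegral_measure_lt {X : Type*} [MeasurableSpace X] (ν : Measure X)
    {F : X → ENNReal} (hF : Measurable F) (T : ℝ) :
    ∫⁻ x, min (F x) (ENNReal.ofReal T) ∂ν = ∫⁻ t in Ioo 0 T, ν {x | ENNReal.ofReal t < F x} := by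
  have hfin : ∀ x, min (F x) (ENNReal.ofReal T) ≠ ⊤ := fun x =>
    (min_lt_of_right_lt ENNReal.ofReal_lt_top).ne
  have h := lintegral_eq_lintegral_meas_lt ν
    (f := fun x => (min (F x) (ENNReal.ofReal T)).toReal)
    (.of_forall fun x => ENNReal.toReal_nonneg)
    (hF.min measurable_const).ennreal_toReal.aemeasurable
  simp only [ENNReal.ofReal_toReal (hfin _)] at h
  rw [h, ← lintegral_indicator measurableSet_Ioi, ← lintegral_indicator measurableSet_Ioo]
  congr 1
  ext t
  by_cases ht : 0 < t
  · have hlt : ∀ x, t < (min (F x) (ENNReal.ofReal T)).toReal ↔ ENNReal.ofReal t < F x ∧ t < T :=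
      fun x => by
        rw [← ENNReal.ofReal_lt_iff_lt_toReal ht.le (hfin x), lt_min_iff,
          ENNReal.ofReal_lt_ofReal_iff_of_nonneg ht.le]
    by_cases htT : t < T <;> simp [indicator, ht, htT, hlt]
  · simp [indicator, ht]

/-- Let `T` be the first level with at least `M / α` of the mass of `F` on `{F ≤ T}`. If every `t <
T` failed, integrating over `(0, T)` would give `∫ min F T ≤ M / α`; but this integral is the mass
on `{F ≤ T}` plus `T * ν {F > T}`, which exceeds `M / α`. -/
theorem exists_level_lt {X : Type*} [MeasurableSpace X] {ν : Measure X} {F F' : X → ENNReal}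
    (hF : Measurable F) (hF' : Measurable F') (hpos : ∫⁻ x, F x ∂ν ≠ 0)
    (hfin : ∫⁻ x, F x ∂ν ≠ ⊤) {K α : ENNReal} (hK : ∫⁻ x, F' x ∂ν ≤ K * ∫⁻ x, F x ∂ν)
    (hK0 : K ≠ 0) (hKtop : K ≠ ⊤) (hα : 1 < α) (hαtop : α ≠ ⊤) :
    ∃ t : ENNReal, t ≠ ⊤ ∧ ν {x | t < F' x} < α * K * ν {x | t < F x} ∧
      ∫⁻ x in {x | F x ≤ t}, F x ∂ν < (∫⁻ x, F x ∂ν) / α := by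
  have hα0 : α ≠ 0 := (zero_lt_one.trans hα).ne'
  set M := ∫⁻ x, F x ∂ν with hM
  have hMα : M / α < M := by
    refine ENNReal.div_lt_of_lt_mul ?_
    conv_lhs => rw [← mul_one M]
    exact (ENNReal.mul_lt_mul_iff_right hpos hfin).2 hα
  have hmle : ∀ t, MeasurableSet {x | F x ≤ t} := fun t => measurableSet_le hF measurable_const
  have hmlt : ∀ t, MeasurableSet {x | t < F x} := fun t => measurableSet_lt measurable_const hF
  by_contra! hcon
  set ρ := ν.withDensity F with hρ
  have hρa : ∀ s, MeasurableSet s → ρ s = ∫⁻ x in s, F x ∂ν := fun s hs => withDensity_apply F hs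
  have hρuniv : ρ univ = M := by rw [hρa _ .univ, setLIntegral_univ]
  have : IsFiniteMeasure ρ := ⟨hρuniv ▸ hfin.lt_top⟩
  let S : Set ℝ := {t | 0 ≤ t ∧ M / α ≤ ρ {x | F x ≤ ENNReal.ofReal t}}
  have hSne : S.Nonempty := by
    have hU : ρ (⋃ n : ℕ, {x | F x ≤ n}) = M := by
      rw [← hρuniv]
      refine measure_congr (eventuallyEq_univ.2 ?_)
      have : ∀ᵐ x ∂ρ, F x < ⊤ := (withDensity_absolutelyContinuous ν F) (ae_lt_top hF hfin)
      filter_upwards [this] with x hx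
      obtain ⟨n, hn⟩ := ENNReal.exists_nat_gt hx.ne
      exact mem_iUnion.2 ⟨n, hn.le⟩
    have hmono : Monotone fun n : ℕ => {x | F x ≤ n} :=
      fun m n h x (hx : F x ≤ m) => hx.trans (Nat.cast_le.2 h)
    rw [hmono.measure_iUnion] at hU
    obtain ⟨n, hn⟩ := lt_iSup_iff.1 (hMα.trans_eq hU.symm)
    exact ⟨n, n.cast_nonneg, by simpa using hn.le⟩
  have hSbdd : BddBelow S := ⟨0, fun t ht => ht.1⟩
  set T := sInf S with hT
  have hT0 : 0 ≤ T := le_csInf hSne fun t ht => ht.1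
  -- The infimum is attained, by continuity from above of the finite measure `ρ`.
  have hTS : M / α ≤ ρ {x | F x ≤ ENNReal.ofReal T} := by
    have hI : {x | F x ≤ ENNReal.ofReal T} =
        ⋂ n : ℕ, {x | F x ≤ ENNReal.ofReal (T + 1 / (n + 1))} := by
      ext x
      simp only [mem_ofPred_eq, mem_iInter]
      refine ⟨fun h n => h.trans (ENNReal.ofReal_le_ofReal ?_), fun h => ?_⟩
      · have : (0 : ℝ) < 1 / (n + 1) := by positivity
        linarith
      · have hl : Tendsto (fun n : ℕ => ENNReal.ofReal (T + 1 / (n + 1))) atTop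
            (𝓝 (ENNReal.ofReal T)) := by
          refine (ENNReal.continuous_ofReal.tendsto T).comp ?_
          simpa using (tendsto_one_div_add_atTop_nhds_zero_nat (𝕜 := ℝ)).const_add T
        exact ge_of_tendsto' hl h
    have hanti : Antitone fun n : ℕ => {x | F x ≤ ENNReal.ofReal (T + 1 / (n + 1))} :=
      fun m n hmn x hx => le_trans hx (ENNReal.ofReal_le_ofReal (by gcongr))
    rw [hI, hanti.measure_iInter (fun n => (hmle _).nullMeasurableSet) ⟨0, measure_ne_top _ _⟩]
    refine le_iInf fun n => ?_
    have : T < T + 1 / ((n : ℝ) + 1) := by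
      have : (0 : ℝ) < 1 / (n + 1) := by positivity
      linarith
    obtain ⟨s, hs, hsT⟩ := exists_lt_of_csInf_lt hSne this
    exact hs.2.trans (measure_mono fun x hx => le_trans hx (ENNReal.ofReal_le_ofReal hsT.le))
  have hTne : ENNReal.ofReal T ≠ 0 := by
    intro h
    rw [h, hρa _ (hmle 0)] at hTS
    have h0 : ∫⁻ x in {x | F x ≤ 0}, F x ∂ν = 0 := by
      rw [setLIntegral_congr_fun (g := 0) (hmle 0) fun x hx => le_antisymm hx bot_le]
      simp
    rw [h0] at hTS
    exact (ENNReal.div_pos hpos hαtop).ne' (le_antisymm hTS bot_le)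
  have hI_le : ∫⁻ x, min (F x) (ENNReal.ofReal T) ∂ν ≤ M / α := by
    rw [ENNReal.le_div_iff_mul_le (.inl hα0) (.inl hαtop), mul_comm]
    rw [← ENNReal.mul_le_mul_iff_right hK0 hKtop, ← mul_assoc, mul_comm K α]
    refine le_trans ?_ hK
    calc α * K * ∫⁻ x, min (F x) (ENNReal.ofReal T) ∂ν
        = ∫⁻ t in Ioo 0 T, α * K * ν {x | ENNReal.ofReal t < F x} := by
          rw [lintegral_min_eq_setLIntegral_measure_lt ν hF,
            lintegral_const_mul' _ _ (ENNReal.mul_ne_top hαtop hKtop)]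
      _ ≤ ∫⁻ t in Ioo 0 T, ν {x | ENNReal.ofReal t < F' x} := by
          refine setLIntegral_mono' measurableSet_Ioo fun t ht => ?_
          -- A level `t < T` is not in `S`, so the mass condition holds there and only the ratio
          -- condition can fail.
          by_contra! hlt
          refine notMem_of_lt_csInf ht.2 hSbdd ⟨ht.1.le, ?_⟩
          rw [hρa _ (hmle _)]
          exact hcon _ ENNReal.ofReal_ne_top hlt
      _ = ∫⁻ x, min (F' x) (ENNReal.ofReal T) ∂ν :=
          (lintegral_min_eq_setLIntegral_measure_lt ν hF' T).symm
      _ ≤ ∫⁻ x, F' x ∂ν := lintegral_mono fun x => min_le_left _ _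
  refine hI_le.not_gt ?_
  have hsplit : ∫⁻ x, min (F x) (ENNReal.ofReal T) ∂ν =
      ρ {x | F x ≤ ENNReal.ofReal T} + ENNReal.ofReal T * ν {x | ENNReal.ofReal T < F x} := by
    rw [← lintegral_add_compl _ (hmle (ENNReal.ofReal T)), hρa _ (hmle _)]
    congr 1
    · exact setLIntegral_congr_fun (hmle _) fun x hx => min_eq_left hx
    · have hc : {x | F x ≤ ENNReal.ofReal T}ᶜ = {x | ENNReal.ofReal T < F x} := by
        ext x
        simp
      rw [hc, setLIntegral_congr_fun (g := fun _ => ENNReal.ofReal T) (hmlt _)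
        fun x hx => min_eq_right (le_of_lt hx), setLIntegral_const]
  rw [hsplit]
  -- Strictness comes from `M > M / α` if `F ≤ T` almost everywhere, and otherwise from the positive
  -- second term.
  by_cases h0 : ν {x | ENNReal.ofReal T < F x} = 0
  · have : ρ {x | F x ≤ ENNReal.ofReal T} = M := by
      rw [← hρuniv]
      refine measure_congr (eventuallyEq_univ.2 ?_)
      have h1 := withDensity_absolutelyContinuous ν F h0
      rw [mem_ae_iff]
      convert h1 using 2
      ext x
      simp
    rw [this]
    exact hMα.trans_le le_self_add
  · exact hTS.trans_lt (ENNReal.lt_add_right (measure_ne_top _ _) (mul_ne_zero hTne h0))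

/-! ### Weil's formula, via a regular content. -/

section Extension

variable {G : Type*} [Group G] [TopologicalSpace G] [IsTopologicalGroup G]
  [LocallyCompactSpace G] [T2Space G] [MeasurableSpace G] [BorelSpace G]
  {H : Subgroup G} {ρ : Measure G}
  [MeasurableSpace (G ⧸ H)] [BorelSpace (G ⧸ H)]

namespace IsSubgroupHaar

theorem fiberMeasure_lt_top (hρ : IsSubgroupHaar H ρ) {K : Set G} (hK : IsCompact K)
    (x : G ⧸ H) : fiberMeasure ρ K x < ⊤ :=
  hρ.lt_top _ (hK.smul _)

theorem measurable_fiberMeasure_of_isCompact (hρ : IsSubgroupHaar H ρ) {K : Set G}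
    (hK : IsCompact K) : Measurable (fiberMeasure (H := H) ρ K) :=
  (hρ.upperSemicontinuous_fiberMeasure hK).measurable

theorem setLIntegral_fiberMeasure (hρ : IsSubgroupHaar H ρ) {ν : Measure (G ⧸ H)} {S : Set G}
    {T : Set (G ⧸ H)} (hT : MeasurableSet T) (hST : ((↑) : G → G ⧸ H) '' S ⊆ T) :
    ∫⁻ x in T, fiberMeasure ρ S x ∂ν = ∫⁻ x, fiberMeasure ρ S x ∂ν := by
  rw [← lintegral_indicator hT, indicator_eq_self.2]
  intro x hx
  by_contra hxT
  exact hx (hρ.fiberMeasure_eq_zero fun h => hxT (hST h))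

theorem lintegral_fiberMeasure_lt_top [T2Space (G ⧸ H)] (hρ : IsSubgroupHaar H ρ)
    (ν : Measure (G ⧸ H)) [IsFiniteMeasureOnCompacts ν] {K : Set G} (hK : IsCompact K) :
    ∫⁻ x, fiberMeasure ρ K x ∂ν < ⊤ := by
  have hc : IsCompact (((↑) : G → G ⧸ H) '' K) := hK.image QuotientGroup.continuous_mk
  rw [← hρ.setLIntegral_fiberMeasure hc.measurableSet subset_rfl]
  rcases eq_empty_or_nonempty (((↑) : G → G ⧸ H) '' K) with he | hne
  · simp [he]
  obtain ⟨x₀, -, hmax⟩ := UpperSemicontinuousOn.exists_isMaxOn hne hc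
    ((hρ.upperSemicontinuous_fiberMeasure hK).upperSemicontinuousOn _)
  calc _ ≤ ∫⁻ _ in ((↑) : G → G ⧸ H) '' K, fiberMeasure ρ K x₀ ∂ν :=
        setLIntegral_mono' hc.measurableSet fun x hx => hmax hx
    _ < ⊤ := by
        rw [setLIntegral_const]
        exact ENNReal.mul_lt_top (hρ.fiberMeasure_lt_top hK _) hc.measure_lt_top

theorem exists_isCompact_fiberMeasure_lt (hρ : IsSubgroupHaar H ρ) {K : Set G} (hK : IsCompact K)
    (x : G ⧸ H) {r : ENNReal} (hr : fiberMeasure ρ K x < r) :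
    ∃ L, IsCompact L ∧ K ⊆ interior L ∧ fiberMeasure ρ L x < r := by
  obtain ⟨U, hKU, hU, hUr⟩ := hρ.exists_isOpen _ (hK.smul x.out⁻¹) r hr
  obtain ⟨L, hL, hKL, hLU⟩ := exists_compact_between hK (hU.smul x.out) (subset_smul_set_iff.2 hKU)
  exact ⟨L, hL, hKL, (measure_mono (subset_smul_set_iff.1 hLU)).trans_lt hUr⟩

/-- The content on `G` obtained by integrating fibre measures over `G ⧸ H`. -/
noncomputable def content [T2Space (G ⧸ H)] (hρ : IsSubgroupHaar H ρ) (ν : Measure (G ⧸ H))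
    [IsFiniteMeasureOnCompacts ν] : Content G where
  toFun K := (∫⁻ x, fiberMeasure (H := H) ρ K x ∂ν).toNNReal
  mono' K L h := ENNReal.toNNReal_mono (hρ.lintegral_fiberMeasure_lt_top ν L.isCompact).ne
    (lintegral_mono fun x => fiberMeasure_mono ρ h x)
  sup_disjoint' K L h _ hL := by
    rw [← ENNReal.toNNReal_add (hρ.lintegral_fiberMeasure_lt_top ν K.isCompact).ne
      (hρ.lintegral_fiberMeasure_lt_top ν L.isCompact).ne,
      ← lintegral_add_left (hρ.measurable_fiberMeasure_of_isCompact K.isCompact)]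
    simp only [TopologicalSpace.Compacts.coe_sup, fiberMeasure_union ρ h hL.measurableSet]
  sup_le' K L := by
    rw [← ENNReal.toNNReal_add (hρ.lintegral_fiberMeasure_lt_top ν K.isCompact).ne
      (hρ.lintegral_fiberMeasure_lt_top ν L.isCompact).ne,
      ← lintegral_add_left (hρ.measurable_fiberMeasure_of_isCompact K.isCompact)]
    refine ENNReal.toNNReal_mono ?_ (lintegral_mono fun x => fiberMeasure_union_le ρ _ _ x)
    rw [lintegral_add_left (hρ.measurable_fiberMeasure_of_isCompact K.isCompact)]
    exact ENNReal.add_ne_top.2 ⟨(hρ.lintegral_fiberMeasure_lt_top ν K.isCompact).ne,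
      (hρ.lintegral_fiberMeasure_lt_top ν L.isCompact).ne⟩

theorem content_apply [T2Space (G ⧸ H)] (hρ : IsSubgroupHaar H ρ) (ν : Measure (G ⧸ H))
    [IsFiniteMeasureOnCompacts ν] (K : TopologicalSpace.Compacts G) :
    hρ.content ν K = ∫⁻ x, fiberMeasure (H := H) ρ K x ∂ν :=
  ENNReal.coe_toNNReal (hρ.lintegral_fiberMeasure_lt_top ν K.isCompact).ne

/-- Regularity makes the induced measure agree with the content on compact sets. By
Vitali–Carathéodory, a lower semicontinuous `g` lies strictly above the fibre function of `K` at
small cost in integral. Near each point some compact neighbourhood of `K` has fibre measure below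
`g`; finitely many such neighbourhoods are intersected. -/
theorem contentRegular_content [T2Space (G ⧸ H)] (hρ : IsSubgroupHaar H ρ) (ν : Measure (G ⧸ H))
    [ν.Regular] : (hρ.content ν).ContentRegular := by
  intro K
  refine le_antisymm (le_iInf₂ fun L hL => (hρ.content ν).mono _ _ (hL.trans interior_subset)) ?_
  refine ENNReal.le_of_forall_pos_le_add fun ε hε _ => ?_
  obtain ⟨K₀, hK₀, hKK₀⟩ := exists_compact_superset K.isCompact
  set Q : Set (G ⧸ H) := ((↑) : G → G ⧸ H) '' K₀
  have hQc : IsCompact Q := hK₀.image QuotientGroup.continuous_mk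
  have : (ν.restrict Q).Regular := Measure.Regular.restrict_of_measure_ne_top hQc.measure_ne_top
  have : IsFiniteMeasure (ν.restrict Q) := ⟨by simpa using hQc.measure_lt_top⟩
  obtain ⟨g, hfg, hg, hgi⟩ := exists_lt_lowerSemicontinuous_lintegral_ge (ν.restrict Q)
    (fun x => (fiberMeasure ρ (K : Set G) x).toNNReal)
    (hρ.measurable_fiberMeasure_of_isCompact K.isCompact).ennreal_toNNReal
    (ENNReal.coe_ne_zero.2 hε.ne')
  simp only [ENNReal.coe_toNNReal (hρ.fiberMeasure_lt_top K.isCompact _).ne] at hfg hgi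
  have key : ∃ L, IsCompact L ∧ (K : Set G) ⊆ interior L ∧ L ⊆ K₀ ∧
      ∀ y ∈ Q, fiberMeasure ρ L y < g y := by
    refine hQc.induction_on (p := fun s => ∃ L, IsCompact L ∧ (K : Set G) ⊆ interior L ∧ L ⊆ K₀ ∧
      ∀ y ∈ s, fiberMeasure ρ L y < g y) ⟨K₀, hK₀, hKK₀, subset_rfl, by simp⟩ ?_ ?_ ?_
    · rintro s t hst ⟨L, h1, h2, h3, h4⟩
      exact ⟨L, h1, h2, h3, fun y hy => h4 y (hst hy)⟩
    · rintro s t ⟨L, h1, h2, h3, h4⟩ ⟨L', h1', h2', h3', h4'⟩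
      refine ⟨L ∩ L', h1.inter h1', ?_, inter_subset_left.trans h3, ?_⟩
      · rw [interior_inter]
        exact subset_inter h2 h2'
      · rintro y (hy | hy)
        · exact (fiberMeasure_mono ρ inter_subset_left y).trans_lt (h4 y hy)
        · exact (fiberMeasure_mono ρ inter_subset_right y).trans_lt (h4' y hy)
    · intro x _
      obtain ⟨L, h1, h2, h3⟩ := hρ.exists_isCompact_fiberMeasure_lt K.isCompact x (hfg x)
      obtain ⟨r, hr1, hr2⟩ := exists_between h3
      refine ⟨_, nhdsWithin_le_nhds (((hρ.upperSemicontinuous_fiberMeasure h1) x r hr1).and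
        (hg x r hr2)), L ∩ K₀, h1.inter hK₀, ?_, inter_subset_right, ?_⟩
      · rw [interior_inter]
        exact subset_inter h2 hKK₀
      · rintro y ⟨hy1, hy2⟩
        exact (fiberMeasure_mono ρ inter_subset_left y).trans_lt (hy1.trans hy2)
  obtain ⟨L, hLc, hKL, hLK₀, hLg⟩ := key
  refine (iInf₂_le ⟨L, hLc⟩ hKL).trans ?_
  rw [hρ.content_apply, hρ.content_apply, TopologicalSpace.Compacts.coe_mk,
    ← hρ.setLIntegral_fiberMeasure hQc.measurableSet (image_mono hLK₀),
    ← hρ.setLIntegral_fiberMeasure hQc.measurableSet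
      (image_mono (hKK₀.trans interior_subset))]
  exact (setLIntegral_mono' hQc.measurableSet fun y hy => (hLg y hy).le).trans hgi

/-- **Weil's formula** for compact sets. -/
theorem exists_isHaarMeasure_eq_lintegral [T2Space (G ⧸ H)] [H.Normal] (hρ : IsSubgroupHaar H ρ)
    (ν : Measure (G ⧸ H)) [ν.IsHaarMeasure] [ν.Regular] :
    ∃ μ : Measure G, μ.IsHaarMeasure ∧
      ∀ K, IsCompact K → μ K = ∫⁻ x, fiberMeasure (H := H) ρ K x ∂ν := by
  have hμ : ∀ K (hK : IsCompact K), (hρ.content ν).measure K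
      = ∫⁻ x, fiberMeasure (H := H) ρ K x ∂ν := fun K hK =>
    ((hρ.content ν).measure_eq_content_of_regular (hρ.contentRegular_content ν)
      ⟨K, hK⟩).trans (hρ.content_apply ν ⟨K, hK⟩)
  refine ⟨(hρ.content ν).measure, ?_, hμ⟩
  have hinv : (hρ.content ν).measure.IsMulLeftInvariant := by
    refine ⟨fun g => ?_⟩
    ext S hS
    rw [Measure.map_apply (measurable_const_mul g) hS, Content.measure_apply _ hS,
      Content.measure_apply _ (measurable_const_mul g hS)]
    refine (hρ.content ν).is_mul_left_invariant_outerMeasure (fun a K => ?_) g S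
    rw [hρ.content_apply, hρ.content_apply]
    have : ∀ x : G ⧸ H, fiberMeasure ρ (K.map _ (continuous_const_mul a) : Set G) x =
        fiberMeasure ρ (K : Set G) ((a⁻¹ : G) • x) := fun x =>
      hρ.fiberMeasure_smul K.isCompact.measurableSet a x
    simp only [this]
    exact lintegral_mul_left_eq_self (μ := ν) (fun x => fiberMeasure ρ (K : Set G) x)
      ((a⁻¹ : G) : G ⧸ H)
  obtain ⟨K, hK, hK1⟩ := exists_compact_mem_nhds (1 : G)
  have hKi : (interior K).Nonempty := ⟨1, mem_interior_iff_mem_nhds.2 hK1⟩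
  refine Measure.isHaarMeasure_of_isCompact_nonempty_interior _ K hK hKi ?_ ?_
  · rw [hμ K hK, ← pos_iff_ne_zero]
    have hQ : IsOpen (((↑) : G → G ⧸ H) '' interior K) :=
      QuotientGroup.isOpenMap_coe _ isOpen_interior
    refine (lintegral_pos_iff_support (hρ.measurable_fiberMeasure_of_isCompact hK)).2
      ((hQ.measure_pos ν (hKi.image _)).trans_le (measure_mono ?_))
    rintro _ ⟨k, hk, rfl⟩
    exact ((hρ.fiberMeasure_pos isOpen_interior hk).trans_le
      (fiberMeasure_mono ρ interior_subset _)).ne'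
  · rw [hμ K hK]
    exact (hρ.lintegral_fiberMeasure_lt_top ν hK).ne

end IsSubgroupHaar

end Extension

/-! ### From compact to σ-compact sets. -/

theorem IsSigmaCompact.exists_monotone {X : Type*} [TopologicalSpace X] {S : Set X}
    (hS : IsSigmaCompact S) :
    ∃ C : ℕ → Set X, Monotone C ∧ (∀ n, IsCompact (C n)) ∧ ⋃ n, C n = S := by
  obtain ⟨C, hC, rfl⟩ := hS
  exact ⟨accumulate C, monotone_accumulate, isCompact_accumulate hC, iUnion_accumulate⟩

theorem IsSigmaCompact.mul {X : Type*} [TopologicalSpace X] [Mul X] [ContinuousMul X]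
    {S T : Set X} (hS : IsSigmaCompact S) (hT : IsSigmaCompact T) : IsSigmaCompact (S * T) := by
  obtain ⟨C, hCm, hC, rfl⟩ := hS.exists_monotone
  obtain ⟨D, hDm, hD, rfl⟩ := hT.exists_monotone
  refine ⟨fun n => C n * D n, fun n => (hC n).mul (hD n), ?_⟩
  refine subset_antisymm (iUnion_subset fun n => mul_subset_mul (subset_iUnion C n)
    (subset_iUnion D n)) ?_
  rintro _ ⟨x, hx, y, hy, rfl⟩
  obtain ⟨m, hm⟩ := mem_iUnion.1 hx
  obtain ⟨n, hn⟩ := mem_iUnion.1 hy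
  exact mem_iUnion.2 ⟨max m n, mul_mem_mul (hCm (le_max_left m n) hm) (hDm (le_max_right m n) hn)⟩

theorem IsSigmaCompact.measurableSet {X : Type*} [TopologicalSpace X] [T2Space X]
    [MeasurableSpace X] [OpensMeasurableSpace X] {S : Set X} (hS : IsSigmaCompact S) :
    MeasurableSet S := by
  obtain ⟨C, hC, rfl⟩ := hS
  exact .iUnion fun n => (hC n).measurableSet

section Extension

variable {G : Type*} [Group G] [TopologicalSpace G] [IsTopologicalGroup G]
  [LocallyCompactSpace G] [T2Space G] [MeasurableSpace G] [BorelSpace G]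

/-- Neither measure is assumed regular: proportionality is used on compact sets and passes to
increasing unions. -/
theorem measure_eq_haarScalarFactor_smul_of_isSigmaCompact (μ' μ : Measure G) [μ'.IsHaarMeasure]
    [μ.IsHaarMeasure] {S : Set G} (hS : IsSigmaCompact S) :
    μ' S = (Measure.haarScalarFactor μ' μ : ENNReal) * μ S := by
  obtain ⟨C, hCm, hC, rfl⟩ := hS.exists_monotone
  rw [hCm.measure_iUnion, hCm.measure_iUnion, ENNReal.mul_iSup]
  congr 1
  ext n
  rw [Measure.measure_isMulInvariant_eq_smul_of_isCompact_closure μ' μ (hC n).closure]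
  rfl

variable {H : Subgroup G} {ρ : Measure G} [MeasurableSpace (G ⧸ H)] [BorelSpace (G ⧸ H)]

namespace IsSubgroupHaar

theorem measurable_fiberMeasure (hρ : IsSubgroupHaar H ρ) {S : Set G} (hS : IsSigmaCompact S) :
    Measurable (fiberMeasure (H := H) ρ S) := by
  obtain ⟨C, hCm, hC, rfl⟩ := hS.exists_monotone
  simp only [funext (fiberMeasure_iUnion ρ hCm)]
  exact .iSup fun n => hρ.measurable_fiberMeasure_of_isCompact (hC n)

theorem measure_eq_lintegral_of_isSigmaCompact (hρ : IsSubgroupHaar H ρ) {ν : Measure (G ⧸ H)}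
    {μ : Measure G} (h : ∀ K, IsCompact K → μ K = ∫⁻ x, fiberMeasure (H := H) ρ K x ∂ν)
    {S : Set G} (hS : IsSigmaCompact S) : μ S = ∫⁻ x, fiberMeasure (H := H) ρ S x ∂ν := by
  obtain ⟨C, hCm, hC, rfl⟩ := hS.exists_monotone
  simp only [fiberMeasure_iUnion ρ hCm]
  rw [hCm.measure_iUnion, lintegral_iSup
    (fun n => hρ.measurable_fiberMeasure_of_isCompact (hC n))
    fun m n hmn x => fiberMeasure_mono ρ (hCm hmn) x]
  simp only [h _ (hC _)]

/-- The part of a σ-compact set lying over a superlevel set of its fibre measure is exhausted by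
compact sets whose images exhaust the superlevel set. -/
theorem exists_isCompact_exhaustion (hρ : IsSubgroupHaar H ρ) {A : Set G} (hA : IsSigmaCompact A)
    {t : ENNReal} (ht : t ≠ ⊤) :
    ∃ E : ℕ → Set G, Monotone E ∧ (∀ n, IsCompact (E n)) ∧
      ⋃ n, E n = A ∩ ((↑) : G → G ⧸ H) ⁻¹' {x | t < fiberMeasure ρ A x} ∧
      ⋃ n, ((↑) : G → G ⧸ H) '' E n = {x | t < fiberMeasure ρ A x} := by
  obtain ⟨C, hCm, hC, rfl⟩ := hA.exists_monotone
  set A := ⋃ n, C n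
  -- Levels decreasing to `t` from strictly above allow closed conditions `r n ≤ _`, which upper
  -- semicontinuity turns into closed sets, while the union still gives the strict condition `t <
  -- _`.
  let r : ℕ → ENNReal := fun n => t + ((n : ENNReal) + 1)⁻¹
  have hr : Antitone r := fun m n hmn => by
    simp only [r]
    gcongr
  have hrt : ∀ n, t < r n := fun n => ENNReal.lt_add_right ht (by simp)
  have hlim : Tendsto r atTop (𝓝 t) := by
    have := ENNReal.tendsto_inv_nat_nhds_zero.comp (tendsto_add_atTop_nat 1)
    simpa [r, Function.comp_def] using this.const_add t
  let E : ℕ → Set G := fun n => C n ∩ ((↑) : G → G ⧸ H) ⁻¹' {x | r n ≤ fiberMeasure ρ (C n) x}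
  have hEm : Monotone E := fun m n hmn a ha =>
    ⟨hCm hmn ha.1, (hr hmn).trans (le_trans ha.2 (fiberMeasure_mono ρ (hCm hmn) _))⟩
  have hex : ∀ x : G ⧸ H, t < fiberMeasure ρ A x →
      ∃ N, ∀ n, N ≤ n → r n ≤ fiberMeasure ρ (C n) x := fun x hx => by
    rw [fiberMeasure_iUnion ρ hCm] at hx
    obtain ⟨k, hk⟩ := lt_iSup_iff.1 hx
    obtain ⟨N, hN⟩ := eventually_atTop.1 (hlim.eventually (gt_mem_nhds hk))
    exact ⟨max k N, fun n hn => (hN n (le_of_max_le_right hn)).le.trans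
      (fiberMeasure_mono ρ (hCm (le_of_max_le_left hn)) x)⟩
  have hsub : ∀ n, E n ⊆ A ∩ ((↑) : G → G ⧸ H) ⁻¹' {x | t < fiberMeasure ρ A x} :=
    fun n a ha => ⟨mem_iUnion.2 ⟨n, ha.1⟩,
      (hrt n).trans_le (le_trans ha.2 (fiberMeasure_mono ρ (subset_iUnion C n) _))⟩
  refine ⟨E, hEm, fun n => ?_, subset_antisymm (iUnion_subset hsub) ?_,
    subset_antisymm (iUnion_subset fun n => ?_) ?_⟩
  · refine (hC n).inter_right (IsClosed.preimage QuotientGroup.continuous_mk ?_)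
    exact (hρ.upperSemicontinuous_fiberMeasure (hC n)).isClosed_preimage (r n)
  · rintro a ⟨ha, hat⟩
    obtain ⟨k, hk⟩ := mem_iUnion.1 ha
    obtain ⟨N, hN⟩ := hex _ hat
    exact mem_iUnion.2 ⟨max k N, hCm (le_max_left k N) hk, hN _ (le_max_right k N)⟩
  · rintro _ ⟨a, ha, rfl⟩
    exact (hsub n ha).2
  · intro x hx
    obtain ⟨N, hN⟩ := hex x hx
    have hxN : x ∈ ((↑) : G → G ⧸ H) '' C N := by
      by_contra hxC
      exact (((bot_le (a := t)).trans_lt (hrt N)).trans_le (hN N le_rfl)).ne'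
        (hρ.fiberMeasure_eq_zero hxC)
    obtain ⟨a, ha, rfl⟩ := hxN
    exact mem_iUnion.2 ⟨N, a, ⟨ha, hN N le_rfl⟩, rfl⟩

end IsSubgroupHaar

end Extension

/-! ### The main theorem. -/

theorem theorem5p1 {G : Type*} [Group G] [TopologicalSpace G] [IsTopologicalGroup G]
    [LocallyCompactSpace G] [T2Space G] [MeasurableSpace G] [BorelSpace G]
    (μ : MeasureTheory.Measure G) [μ.IsHaarMeasure] [μ.IsMulRightInvariant]
    (H : Subgroup G) [H.Normal] (hH : IsClosed (H : Set G))
    [MeasurableSpace (G ⧸ H)] [BorelSpace (G ⧸ H)]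
    (ν : MeasureTheory.Measure (G ⧸ H)) [ν.IsHaarMeasure]
    (A : Set G) (hA : IsSigmaCompact A) (hA_pos : 0 < μ A) (hA_fin : μ A < ⊤)
    (K : ℝ) (hK : μ (A * A) ≤ ENNReal.ofReal K * μ A)
    (α : ℝ) (hα : 1 < α) :
    ∃ B : Set G, B ⊆ A ∧ IsCompact B ∧
      ENNReal.ofReal ((α - 1) / α) * μ A < μ B ∧
      ν ((QuotientGroup.mk' H '' B) * (QuotientGroup.mk' H '' B)) <
        ENNReal.ofReal (α * K) * ν (QuotientGroup.mk' H '' B) := by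
  have : T2Space (G ⧸ H) := inferInstance
  have hα0 : 0 < α := zero_lt_one.trans hα
  obtain ⟨ρ, hρ⟩ := exists_isSubgroupHaar H hH
  obtain ⟨μ', hμ', hW⟩ := hρ.exists_isHaarMeasure_eq_lintegral (Measure.haar : Measure (G ⧸ H))
  set ν' : Measure (G ⧸ H) := Measure.haar
  set c : ENNReal := (Measure.haarScalarFactor μ μ' : ENNReal)
  set d : ENNReal := (Measure.haarScalarFactor ν ν' : ENNReal)
  have hc0 : c ≠ 0 :=
    ENNReal.coe_ne_zero.2 (Measure.haarScalarFactor_pos_of_isHaarMeasure μ μ').ne'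
  have hd0 : d ≠ 0 :=
    ENNReal.coe_ne_zero.2 (Measure.haarScalarFactor_pos_of_isHaarMeasure ν ν').ne'
  have hct : c ≠ ⊤ := ENNReal.coe_ne_top
  have hdt : d ≠ ⊤ := ENNReal.coe_ne_top
  have hμ : ∀ S, IsSigmaCompact S → μ S = c * μ' S := fun S hS =>
    measure_eq_haarScalarFactor_smul_of_isSigmaCompact μ μ' hS
  have hν : ∀ S, IsSigmaCompact S → ν S = d * ν' S := fun S hS =>
    measure_eq_haarScalarFactor_smul_of_isSigmaCompact ν ν' hS
  have hAA := hA.mul hA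
  have hWs : ∀ S, IsSigmaCompact S → μ' S = ∫⁻ x, fiberMeasure ρ S x ∂ν' := fun S hS =>
    hρ.measure_eq_lintegral_of_isSigmaCompact hW hS
  have hne : A.Nonempty := nonempty_of_measure_ne_zero hA_pos.ne'
  -- `A * A` contains a translate of `A`, so its measure is positive.
  have hK0 : ENNReal.ofReal K ≠ 0 := by
    intro h0
    obtain ⟨a, ha⟩ := hne
    have : μ A ≤ μ (A * A) := by
      rw [← measure_smul μ a A]
      exact measure_mono (smul_set_subset_mul ha)
    rw [h0, zero_mul] at hK
    exact hA_pos.not_ge (this.trans hK)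
  rw [hμ A hA] at hA_pos hA_fin hK ⊢
  rw [hμ _ hAA, mul_left_comm, ENNReal.mul_le_mul_iff_right hc0 hct] at hK
  have hM0 : μ' A ≠ 0 := (ENNReal.mul_pos_iff.1 hA_pos).2.ne'
  have hMt : μ' A ≠ ⊤ := fun h => hA_fin.ne (by rw [h, ENNReal.mul_top hc0])
  rw [hWs A hA] at hM0 hMt
  rw [hWs A hA, hWs _ hAA] at hK
  obtain ⟨t, ht, hlt, htM⟩ := exists_level_lt (hρ.measurable_fiberMeasure hA)
    (hρ.measurable_fiberMeasure hAA) hM0 hMt hK hK0 ENNReal.ofReal_ne_top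
    (ENNReal.one_lt_ofReal.2 hα) ENNReal.ofReal_ne_top
  rw [← hWs A hA] at hM0 hMt htM
  rw [← ENNReal.ofReal_mul hα0.le] at hlt
  obtain ⟨E, hEm, hEc, hEU, hEπ⟩ := hρ.exists_isCompact_exhaustion hA ht
  have hEμ : ENNReal.ofReal ((α - 1) / α) * μ' A < ⨆ n, μ' (E n) := by
    rw [← hEm.measure_iUnion, hWs _ ⟨E, hEc, rfl⟩, hEU]
    simp only [hρ.fiberMeasure_inter_preimage]
    have hm : MeasurableSet {x : G ⧸ H | fiberMeasure ρ A x ≤ t} :=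
      measurableSet_le (hρ.measurable_fiberMeasure hA) measurable_const
    have hcompl : {x : G ⧸ H | t < fiberMeasure ρ A x} = {x | fiberMeasure ρ A x ≤ t}ᶜ := by
      ext x
      simp
    rw [hcompl, lintegral_indicator hm.compl]
    have hsplit := lintegral_add_compl (μ := ν') (fiberMeasure (H := H) ρ A) hm
    rw [← hWs A hA] at hsplit
    have hsum : ENNReal.ofReal ((α - 1) / α) * μ' A + μ' A / ENNReal.ofReal α = μ' A := by
      rw [div_eq_mul_inv (μ' A), ← ENNReal.ofReal_inv_of_pos hα0, mul_comm (μ' A), ← add_mul,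
        ← ENNReal.ofReal_add (div_nonneg (by linarith) hα0.le) (by positivity)]
      have : (α - 1) / α + α⁻¹ = 1 := by
        field_simp
        ring
      rw [this, ENNReal.ofReal_one, one_mul]
    -- The part of `A` over `{F ≤ t}` has measure less than `μ' A / α`, leaving more than the
    -- claimed share.
    refine lt_of_add_lt_add_right (a := μ' A / ENNReal.ofReal α) ?_
    rw [hsum]
    conv_lhs => rw [← hsplit, add_comm]
    refine ENNReal.add_lt_add_left ?_ htM
    exact ne_top_of_le_ne_top hMt (hsplit ▸ le_add_self)
  have hEν : ν' {x : G ⧸ H | t < fiberMeasure ρ (A * A) x} <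
      ⨆ n, ENNReal.ofReal (α * K) * ν' (((↑) : G → G ⧸ H) '' E n) := by
    have hmono : Monotone fun n => ((↑) : G → G ⧸ H) '' E n := fun m n hmn => image_mono (hEm hmn)
    rwa [← ENNReal.mul_iSup, ← hmono.measure_iUnion, hEπ]
  obtain ⟨m, hm⟩ := lt_iSup_iff.1 hEμ
  obtain ⟨n, hn⟩ := lt_iSup_iff.1 hEν
  set k := max m n
  have hEA : E k ⊆ A := fun a ha => (hEU.subset (mem_iUnion.2 ⟨k, ha⟩)).1
  have hEk : IsCompact (((↑) : G → G ⧸ H) '' E k) := (hEc k).image QuotientGroup.continuous_mk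
  refine ⟨E k, hEA, hEc k, ?_, ?_⟩
  · rw [hμ _ (hEc k).isSigmaCompact, mul_left_comm, ENNReal.mul_lt_mul_iff_right hc0 hct]
    exact hm.trans_le (measure_mono (hEm (le_max_left m n)))
  · rw [QuotientGroup.coe_mk', hν _ hEk.isSigmaCompact, hν _ (hEk.mul hEk).isSigmaCompact,
      mul_left_comm, ENNReal.mul_lt_mul_iff_right hd0 hdt]
    refine lt_of_le_of_lt (measure_mono ?_) (hn.trans_le ?_)
    · rintro _ ⟨_, ⟨a, ha, rfl⟩, y, hy, rfl⟩
      have hyt : t < fiberMeasure ρ A y := hEπ.subset (mem_iUnion.2 ⟨k, hy⟩)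
      exact hyt.trans_le (hρ.fiberMeasure_le_mul hA.measurableSet hAA.measurableSet
        ⟨a, hEA ha, rfl⟩)
    · gcongr
      exact hEm (le_max_right m n)
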